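/- Write $(a;q)_m=\prod_{i=0}^{m-1}(1-aq^i)$ and $\left[{n\atop m}\right]_q=(q^{n-m+1};q)_m/(q;q)_m$ for $0\le m\le n$. For all integers $n\ge k\ge 0$, as formal power series in $q$ over $\mathbb{Q}$, $$\left[{n\atop k}\right]_q\frac{(-q^{n-k+1};q)_k}{(q^{2(n-k+1)};q)_k}=\frac{\left[{n\atop \lfloor k/2\rfloor}\right]_{q^2}}{(q;q^2)_{\lceil k/2\rceil}\,(q^{2n-2k+3};q^2)_{\lfloor k/2\rfloor}}.$$ Moreover, this identity is a finitization of the transpose theorem, in the following sense. Fix $k\ge 0$. As $n\to\infty$, for every $N\ge 0$ the coefficient of $q^N$ in the left side is eventually constant and equal to the number of partitions $\lambda_1\ge\cdots\ge\lambda_k\ge 0$ of $N$ into $k$ nonnegative parts, and the coefficient of $q^N$ in the right side is eventually constant and equal to the number of partitions of $N$ with no part larger than $k$. Hence these two numbers are equal. The transpose theorem also holds in its refined form: for all integers $N\ge 0$ and $j$, the number of partitions $\lambda$ of $N$ into $k$ nonnegative parts with $(\lambda_1+\lambda_3+\cdots)-(\lambda_2+\lambda_4+\cdots)=j$ equals the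 number of partitions of $N$ with no part larger than $k$ and exactly $j$ odd parts (counted with multiplicity). -/

import Mathlib

open Filter
open scoped PowerSeries

namespace FinTranspose

/-- The `q`-shifted factorial `(a; q)_m = ∏_{i=0}^{m-1} (1 - a q^i)`. -/
def qPoch {R : Type*} [CommRing R] (a q : R) (m : ℕ) : R :=
  ∏ i ∈ Finset.range m, (1 - a * q ^ i)

/-- The Gaussian polynomial `[n choose m]_Q = (Q^{n-m+1}; Q)_m / (Q; Q)_m`, as a formal power
series, for a base `Q` with zero constant term (so that `(Q; Q)_m` has constant term `1` and
`⁻¹` is a genuine inverse). If `m > n` the truncated exponent is `0` and the value is `0`. -/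
noncomputable def gaussBinom (Q : ℚ⟦X⟧) (n m : ℕ) : ℚ⟦X⟧ :=
  qPoch (Q ^ (n + 1 - m)) Q m * (qPoch Q Q m)⁻¹

/-- The formal variable `q`. -/
noncomputable abbrev q : ℚ⟦X⟧ := PowerSeries.X

/-- `[n choose k]_q (-q^{n-k+1}; q)_k / (q^{2(n-k+1)}; q)_k` (meant for `k ≤ n`, where the
denominator has constant term `1`). -/
noncomputable def lhs (n k : ℕ) : ℚ⟦X⟧ :=
  gaussBinom q n k * qPoch (-q ^ (n - k + 1)) q k * (qPoch (q ^ (2 * (n - k + 1))) q k)⁻¹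

/-- `[n choose ⌊k/2⌋]_{q²} / ((q; q²)_{⌈k/2⌉} (q^{2n-2k+3}; q²)_{⌊k/2⌋})` (meant for `k ≤ n`).
In `ℕ`, `k / 2 = ⌊k/2⌋` and `(k + 1) / 2 = ⌈k/2⌉`. -/
noncomputable def rhs (n k : ℕ) : ℚ⟦X⟧ :=
  gaussBinom (q ^ 2) n (k / 2) *
    (qPoch q (q ^ 2) ((k + 1) / 2) * qPoch (q ^ (2 * (n - k) + 3)) (q ^ 2) (k / 2))⁻¹

/-- Partitions of `N` into `k` nonnegative parts: weakly decreasing tuples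
`l 0 ≥ l 1 ≥ ⋯ ≥ l (k-1) ≥ 0` with sum `N`. -/
def partsPartitions (k N : ℕ) : Finset (Fin k → ℕ) :=
  (Finset.finAntidiagonal k N).filter fun l => Antitone l

/-- `|λ_o| = λ₁ + λ₃ + ⋯`; with indices starting at `0` these are the even indices. -/
def oddIndexSum {k : ℕ} (l : Fin k → ℕ) : ℕ :=
  ∑ i : Fin k, if Even i.val then l i else 0

/-- `|λ_e| = λ₂ + λ₄ + ⋯`; with indices starting at `0` these are the odd indices. -/
def evenIndexSum {k : ℕ} (l : Fin k → ℕ) : ℕ :=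
  ∑ i : Fin k, if Odd i.val then l i else 0

/-- Partitions of `N` with no part larger than `k`. -/
def boundedPartitions (k N : ℕ) : Finset N.Partition :=
  Nat.Partition.restricted N (· ≤ k)

/-- The number of odd parts of a partition, counted with multiplicity. -/
def numOddParts {N : ℕ} (p : N.Partition) : ℕ :=
  p.parts.countP fun i => Odd i

end FinTranspose

/-!
The product identity holds factor by factor. The factors `1 + q ^ (m + i)` and `1 - q ^ (m + i)`,
with `m = n - k + 1`, combine into `1 - (q ^ 2) ^ (m + i)`, so the left side is
`(q ^ (2 m); q ^ 2)_k / ((q; q)_k (q ^ (2 m); q)_k)`. Splitting the indices in `(q; q)_k` and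
`(q ^ (2 m); q)_k` by parity (`qPoch_parity_split`) and the indices in `(q ^ (2 m); q ^ 2)_k` at
`⌈k / 2⌉` (`qPoch_add`), the factor `(q ^ (2 m); q ^ 2)_⌈k / 2⌉` cancels and the right side is left.

As `n → ∞`, every factor whose exponent contains `n` becomes `1` modulo any fixed power of `q`, so
the left side tends to `1 / (q; q)_k`, the generating function of partitions with parts at most `k`.

The combinatorial half is the conjugation bijection `conjugate`: the `i`-th part of the conjugate
of `p` counts the parts of `p` that are greater than `i` (indices from `0`). By double counting
(`sum_mul_countP_lt`), a weighted sum of the conjugate parts with weights `f` is the sum over the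
parts `a` of `p` of `f 0 + ⋯ + f (a - 1)`. The weight `1` gives the size and the weight `(-1) ^ i`
the number of odd parts, hence the refined theorem.
-/

namespace FinTranspose

open PowerSeries

/-! ### Shifted factorials -/

section CommRing

variable {R : Type*} [CommRing R]

theorem qPoch_add (a b Q : R) (c h : ℕ) (hb : b = a * Q ^ c) :
    qPoch a Q (c + h) = qPoch a Q c * qPoch b Q h := by
  subst hb
  simp only [qPoch, Finset.prod_range_add, pow_add, mul_assoc]

/-- Splitting the factors of `(a; Q)_k` by the parity of the index. -/
theorem qPoch_parity_split (a Q : R) (k : ℕ) :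
    qPoch a Q k = qPoch a (Q ^ 2) ((k + 1) / 2) * qPoch (a * Q) (Q ^ 2) (k / 2) := by
  induction k with
  | zero => simp [qPoch]
  | succ k ih =>
    have hstep : qPoch a Q (k + 1) = qPoch a Q k * (1 - a * Q ^ k) := by
      simp [qPoch, Finset.prod_range_succ]
    rw [hstep, ih]
    obtain ⟨r, rfl | rfl⟩ := Nat.even_or_odd' k
    · have h1 : (2 * r + 1 + 1) / 2 = r + 1 := by omega
      have h2 : (2 * r + 1) / 2 = r := by omega
      have h3 : 2 * r / 2 = r := by omega
      rw [h1, h2, h3]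
      simp only [qPoch, Finset.prod_range_succ]
      ring
    · have h1 : (2 * r + 1 + 1 + 1) / 2 = r + 1 := by omega
      have h2 : (2 * r + 1 + 1) / 2 = r + 1 := by omega
      have h3 : (2 * r + 1) / 2 = r := by omega
      rw [h1, h2, h3]
      simp only [qPoch, Finset.prod_range_succ]
      ring

theorem qPoch_mul_qPoch_neg (a Q : R) (k : ℕ) :
    qPoch a Q k * qPoch (-a) Q k = qPoch (a ^ 2) (Q ^ 2) k := by
  simp only [qPoch, ← Finset.prod_mul_distrib]
  refine Finset.prod_congr rfl fun i _ => ?_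
  ring

/-- A shifted factorial is congruent to `1` modulo every divisor of its base point. -/
theorem dvd_qPoch_sub_one {d a : R} (h : d ∣ a) (Q : R) (k : ℕ) : d ∣ qPoch a Q k - 1 := by
  induction k with
  | zero => simp [qPoch]
  | succ k ih =>
    have hstep : qPoch a Q (k + 1) - 1 = (qPoch a Q k - 1) - a * (qPoch a Q k * Q ^ k) := by
      simp only [qPoch, Finset.prod_range_succ]
      ring
    rw [hstep]
    exact dvd_sub ih (h.mul_right _)

end CommRing

theorem constantCoeff_qPoch {a : ℚ⟦X⟧} (h : constantCoeff a = 0) (Q : ℚ⟦X⟧) (k : ℕ) :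
    constantCoeff (qPoch a Q k) = 1 := by
  simp [qPoch, map_prod, h]

/-! ### The product identity -/

theorem mul_inv_eq_mul_inv {a b c d : ℚ⟦X⟧} (hb : constantCoeff b = 1)
    (hd : constantCoeff d = 1) (h : a * d = c * b) : a * b⁻¹ = c * d⁻¹ := by
  have hb' := PowerSeries.mul_inv_cancel b (by simp [hb])
  have hd' := PowerSeries.mul_inv_cancel d (by simp [hd])
  linear_combination (b⁻¹ * d⁻¹) * h - a * b⁻¹ * hd' + c * d⁻¹ * hb'

theorem lhs_eq {n k : ℕ} (hk : k ≤ n) :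
    lhs n k = qPoch (q ^ (2 * (n - k + 1))) (q ^ 2) k *
      (qPoch q q k * qPoch (q ^ (2 * (n - k + 1))) q k)⁻¹ := by
  have hexp : n + 1 - k = n - k + 1 := by omega
  have hnum := qPoch_mul_qPoch_neg (q ^ (n - k + 1)) q k
  rw [← pow_mul, mul_comm (n - k + 1) 2] at hnum
  rw [lhs, gaussBinom, hexp, ← hnum, PowerSeries.mul_inv_rev]
  ring

theorem rhs_eq (n k : ℕ) :
    rhs n k = qPoch ((q ^ 2) ^ (n + 1 - k / 2)) (q ^ 2) (k / 2) *
      (qPoch (q ^ 2) (q ^ 2) (k / 2) *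
        (qPoch q (q ^ 2) ((k + 1) / 2) * qPoch (q ^ (2 * (n - k) + 3)) (q ^ 2) (k / 2)))⁻¹ := by
  rw [rhs, gaussBinom, PowerSeries.mul_inv_rev (qPoch (q ^ 2) (q ^ 2) (k / 2))]
  ring

theorem lhs_eq_rhs {n k : ℕ} (hk : k ≤ n) : lhs n k = rhs n k := by
  rw [lhs_eq hk, rhs_eq]
  refine mul_inv_eq_mul_inv ?_ ?_ ?_
  · rw [map_mul, constantCoeff_qPoch (by simp), constantCoeff_qPoch (by simp), one_mul]
  · rw [map_mul, map_mul, constantCoeff_qPoch (by simp), constantCoeff_qPoch (by simp),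
      constantCoeff_qPoch (by simp), one_mul, one_mul]
  · have hden := qPoch_parity_split (q ^ (2 * (n - k + 1))) q k
    rw [← pow_succ, show 2 * (n - k + 1) + 1 = 2 * (n - k) + 3 by ring] at hden
    have hnum := qPoch_add (q ^ (2 * (n - k + 1))) ((q ^ 2) ^ (n + 1 - k / 2)) (q ^ 2)
      ((k + 1) / 2) (k / 2) (by
        rw [← pow_mul, ← pow_mul, ← pow_add]
        congr 1
        omega)
    rw [show (k + 1) / 2 + k / 2 = k by omega] at hnum
    rw [hnum, hden, qPoch_parity_split q q k, ← pow_two]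
    ring

/-! ### The limit as `n → ∞` -/

theorem X_pow_dvd_lhs_sub {n k M : ℕ} (hM : M + k ≤ n) :
    (PowerSeries.X : ℚ⟦X⟧) ^ M ∣ lhs n k - (qPoch q q k)⁻¹ := by
  rw [lhs_eq (by omega), PowerSeries.mul_inv_rev]
  have hdvd : (PowerSeries.X : ℚ⟦X⟧) ^ M ∣ q ^ (2 * (n - k + 1)) := pow_dvd_pow _ (by omega)
  set A := qPoch (q ^ (2 * (n - k + 1))) (q ^ 2) k with hA
  set B := qPoch (q ^ (2 * (n - k + 1))) q k with hB
  have hB' := PowerSeries.mul_inv_cancel B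
    (by rw [hB, constantCoeff_qPoch (by simp)]; exact one_ne_zero)
  have key : A * (B⁻¹ * (qPoch q q k)⁻¹) - (qPoch q q k)⁻¹ =
      ((A - 1) - (B - 1)) * (B⁻¹ * (qPoch q q k)⁻¹) := by
    linear_combination (qPoch q q k)⁻¹ * hB'
  rw [key]
  exact (dvd_sub (dvd_qPoch_sub_one hdvd _ _) (dvd_qPoch_sub_one hdvd _ _)).mul_right _

open scoped PowerSeries.WithPiTopology in
/-- `1 / (q; q)_k` is the generating function of partitions with no part larger than `k`. -/
theorem mk_card_boundedPartitions (k : ℕ) :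
    PowerSeries.mk (fun N => ((boundedPartitions k N).card : ℚ)) = (qPoch q q k)⁻¹ := by
  let _ : TopologicalSpace ℚ := ⊥
  have _ : DiscreteTopology ℚ := ⟨rfl⟩
  rw [PowerSeries.eq_inv_iff_mul_eq_one (by rw [constantCoeff_qPoch (by simp)]; exact one_ne_zero)]
  have h := Nat.Partition.powerSeriesMk_card_restricted_eq_tprod ℚ (· ≤ k)
  rw [tprod_eq_prod (s := Finset.range k)
    (fun i hi => if_neg (by simpa [Nat.succ_le_iff] using hi))] at h
  unfold boundedPartitions
  rw [h, qPoch, ← Finset.prod_mul_distrib]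
  refine Finset.prod_eq_one fun i hi => ?_
  rw [if_pos (Nat.succ_le_of_lt (Finset.mem_range.mp hi)), ← pow_succ']
  simp_rw [pow_mul]
  exact PowerSeries.WithPiTopology.tsum_pow_mul_one_sub_of_constantCoeff_eq_zero (by simp)

theorem eventually_coeff_lhs (k N : ℕ) :
    ∀ᶠ n in atTop, PowerSeries.coeff N (lhs n k) = ((boundedPartitions k N).card : ℚ) := by
  filter_upwards [eventually_ge_atTop (N + 1 + k)] with n hn
  have h := PowerSeries.X_pow_dvd_iff.mp
    (X_pow_dvd_lhs_sub hn) N (Nat.lt_succ_self N)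
  rw [map_sub, sub_eq_zero] at h
  rw [h, ← mk_card_boundedPartitions, PowerSeries.coeff_mk]

/-! ### Conjugation of partitions -/

/-- The conjugate of a partition, truncated to `k` parts: its `i`-th part, counted from `0`, is the
number of parts of `p` greater than `i`. Nothing is lost when all parts of `p` are at most `k`. -/
def conjugate (k : ℕ) {N : ℕ} (p : N.Partition) : Fin k → ℕ :=
  fun i => p.parts.countP (i.val < ·)

theorem mem_boundedPartitions {k N : ℕ} {p : N.Partition} :
    p ∈ boundedPartitions k N ↔ ∀ a ∈ p.parts, a ≤ k := by
  simp [boundedPartitions, Nat.Partition.restricted]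

theorem mem_partsPartitions {k N : ℕ} {l : Fin k → ℕ} :
    l ∈ partsPartitions k N ↔ ∑ i, l i = N ∧ Antitone l := by
  simp [partsPartitions]

/-- Double counting of the pairs `i < a` with `a` in `s`, each weighted by `f i`. -/
theorem sum_mul_countP_lt (f : ℕ → ℤ) (k : ℕ) (s : Multiset ℕ) (hs : ∀ a ∈ s, a ≤ k) :
    ∑ i ∈ Finset.range k, f i * (s.countP (i < ·) : ℤ) =
      (s.map fun a => ∑ i ∈ Finset.range a, f i).sum := by
  induction s using Multiset.induction_on with
  | empty => simp
  | cons a s ih =>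
    have hfilter : (Finset.range k).filter (· < a) = Finset.range a := by
      have := hs a (Multiset.mem_cons_self a s)
      ext i
      simp only [Finset.mem_filter, Finset.mem_range]
      omega
    rw [Multiset.map_cons, Multiset.sum_cons, ← ih fun b hb => hs b (Multiset.mem_cons_of_mem hb),
      ← hfilter, Finset.sum_filter, ← Finset.sum_add_distrib]
    refine Finset.sum_congr rfl fun i _ => ?_
    rw [Multiset.countP_cons]
    split_ifs <;> push_cast <;> ring

theorem sum_countP_lt {k : ℕ} {s : Multiset ℕ} (hs : ∀ a ∈ s, a ≤ k) :
    ∑ i : Fin k, s.countP (i.val < ·) = s.sum := by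
  have h := sum_mul_countP_lt (fun _ => 1) k s hs
  rw [Fin.sum_univ_eq_sum_range (fun i => s.countP (i < ·)) k]
  zify
  simpa using h

theorem oddIndexSum_sub_evenIndexSum {k : ℕ} (l : Fin k → ℕ) :
    (oddIndexSum l : ℤ) - evenIndexSum l = ∑ i : Fin k, (-1) ^ i.val * (l i : ℤ) := by
  simp only [oddIndexSum, evenIndexSum, Nat.cast_sum, ← Finset.sum_sub_distrib]
  refine Finset.sum_congr rfl fun i _ => ?_
  rcases Nat.even_or_odd i.val with h | h
  · simp [h, h.neg_one_pow]
  · simp [h, h.neg_one_pow]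

theorem alternatingSum_conjugate {k N : ℕ} {p : N.Partition} (hp : p ∈ boundedPartitions k N) :
    (oddIndexSum (conjugate k p) : ℤ) - evenIndexSum (conjugate k p) = numOddParts p := by
  rw [oddIndexSum_sub_evenIndexSum]
  simp only [conjugate]
  rw [Fin.sum_univ_eq_sum_range (fun i => (-1) ^ i * (p.parts.countP (i < ·) : ℤ)) k,
    sum_mul_countP_lt _ k _ (mem_boundedPartitions.mp hp), numOddParts]
  generalize p.parts = s
  induction s using Multiset.induction_on with
  | empty => simp
  | cons a s ih =>
    rw [Multiset.map_cons, Multiset.sum_cons, ih, Multiset.countP_cons, neg_one_geom_sum]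
    rcases Nat.even_or_odd a with h | h
    · simp [h]
    · simp [h, add_comm]

theorem count_add_countP_lt (s : Multiset ℕ) (i : ℕ) :
    s.count (i + 1) + s.countP (i + 1 < ·) = s.countP (i < ·) := by
  induction s using Multiset.induction_on with
  | empty => simp
  | cons a s ih =>
    simp only [Multiset.count_cons, Multiset.countP_cons]
    split_ifs <;> omega

theorem conjugate_mem {k N : ℕ} {p : N.Partition} (hp : p ∈ boundedPartitions k N) :
    conjugate k p ∈ partsPartitions k N := by
  refine mem_partsPartitions.mpr ⟨?_, fun i j hij => ?_⟩
  · exact (sum_countP_lt (mem_boundedPartitions.mp hp)).trans p.parts_sum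
  · simp only [conjugate, Multiset.countP_eq_card_filter]
    exact Multiset.card_le_card
      (Multiset.monotone_filter_right _ fun a ha => lt_of_le_of_lt hij ha)

/-- Consecutive parts of the conjugate differ by the multiplicities of the original partition. -/
theorem conjugate_injOn (k N : ℕ) :
    Set.InjOn (conjugate k) (boundedPartitions k N : Set N.Partition) := by
  intro p hp p' hp' h
  rw [Finset.mem_coe, mem_boundedPartitions] at hp hp'
  have hcount (i : ℕ) : p.parts.countP (i < ·) = p'.parts.countP (i < ·) := by
    by_cases hi : i < k
    · exact congrFun h ⟨i, hi⟩
    · rw [Multiset.countP_eq_zero.mpr fun a ha => by have := hp a ha; omega,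
        Multiset.countP_eq_zero.mpr fun a ha => by have := hp' a ha; omega]
  refine Nat.Partition.ext (Multiset.ext.mpr fun a => ?_)
  cases a with
  | zero =>
    rw [Multiset.count_eq_zero_of_notMem fun h0 => (p.parts_pos h0).false,
      Multiset.count_eq_zero_of_notMem fun h0 => (p'.parts_pos h0).false]
  | succ i =>
    have h1 := count_add_countP_lt p.parts i
    have h2 := count_add_countP_lt p'.parts i
    rw [hcount, hcount] at h1
    omega

/-- The multiset containing `i + 1` with multiplicity `L i - L (i + 1)`, for `i < k`. -/
def multisetOfDiffs (L : ℕ → ℕ) (k : ℕ) : Multiset ℕ :=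
  ∑ i ∈ Finset.range k, Multiset.replicate (L i - L (i + 1)) (i + 1)

theorem mem_multisetOfDiffs {L : ℕ → ℕ} {k a : ℕ} (ha : a ∈ multisetOfDiffs L k) :
    0 < a ∧ a ≤ k := by
  obtain ⟨i, hi, hai⟩ := Multiset.mem_sum.mp ha
  rw [Finset.mem_range] at hi
  have := Multiset.eq_of_mem_replicate hai
  omega

theorem countP_lt_multisetOfDiffs {L : ℕ → ℕ} (hL : Antitone L) {k j : ℕ} (hj : j ≤ k) :
    (multisetOfDiffs L k).countP (j < ·) = L j - L k := by
  induction k, hj using Nat.le_induction with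
  | base =>
    rw [Multiset.countP_eq_zero.mpr fun a ha => (mem_multisetOfDiffs ha).2.not_gt, Nat.sub_self]
  | succ k hjk ih =>
    have h1 := hL hjk
    have h2 := hL k.le_succ
    have hsucc : multisetOfDiffs L (k + 1) =
        multisetOfDiffs L k + Multiset.replicate (L k - L (k + 1)) (k + 1) :=
      Finset.sum_range_succ _ _
    rw [hsucc, Multiset.countP_add, ih, ← Multiset.coe_replicate, Multiset.coe_countP,
      List.countP_replicate, if_pos (by simpa using Nat.lt_succ_of_le hjk)]
    simp only [Nat.succ_eq_add_one] at h2
    omega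

theorem conjugate_surjOn (k N : ℕ) :
    Set.SurjOn (conjugate k) (boundedPartitions k N : Set N.Partition)
      (partsPartitions k N : Set (Fin k → ℕ)) := by
  intro l hl
  obtain ⟨hsum, hanti⟩ := mem_partsPartitions.mp hl
  let L : ℕ → ℕ := fun i => if h : i < k then l ⟨i, h⟩ else 0
  have hL : Antitone L := by
    intro i j hij
    by_cases hj : j < k
    · simpa [L, hj, lt_of_le_of_lt hij hj] using hanti (Fin.mk_le_mk.mpr hij)
    · simp [L, hj]
  have hcount (i : Fin k) : (multisetOfDiffs L k).countP (i.val < ·) = l i := by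
    rw [countP_lt_multisetOfDiffs hL i.isLt.le]
    simp [L]
  refine ⟨⟨multisetOfDiffs L k, fun ha => (mem_multisetOfDiffs ha).1, ?_⟩, ?_, funext hcount⟩
  · rw [← sum_countP_lt fun a ha => (mem_multisetOfDiffs ha).2, ← hsum]
    exact Finset.sum_congr rfl fun i _ => hcount i
  · exact mem_boundedPartitions.mpr fun a ha => (mem_multisetOfDiffs ha).2

theorem image_conjugate (k N : ℕ) :
    (boundedPartitions k N).image (conjugate k) = partsPartitions k N := by
  apply Finset.coe_injective
  rw [Finset.coe_image]
  exact (conjugate_surjOn k N).image_eq_of_mapsTo fun _ hp => conjugate_mem hp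

theorem card_partsPartitions (k N : ℕ) :
    (partsPartitions k N).card = (boundedPartitions k N).card := by
  rw [← image_conjugate, Finset.card_image_of_injOn (conjugate_injOn k N)]

theorem card_partsPartitions_alternatingSum (k N : ℕ) (j : ℤ) :
    ((partsPartitions k N).filter fun l =>
      (oddIndexSum l : ℤ) - (evenIndexSum l : ℤ) = j).card =
    ((boundedPartitions k N).filter fun p => (numOddParts p : ℤ) = j).card := by
  rw [← image_conjugate, Finset.filter_image, Finset.card_image_of_injOn
    ((conjugate_injOn k N).mono (Finset.coe_subset.mpr (Finset.filter_subset _ _)))]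
  refine congrArg Finset.card (Finset.filter_congr fun p hp => ?_)
  rw [alternatingSum_conjugate hp]

end FinTranspose

theorem mainTheorem7 (k : ℕ) :
    -- the identity, for all `n ≥ k ≥ 0`
    (∀ n : ℕ, k ≤ n → FinTranspose.lhs n k = FinTranspose.rhs n k) ∧
    -- as `n → ∞`, the left side converges coefficientwise to the generating function of
    -- partitions into `k` nonnegative parts
    (∀ N : ℕ, ∀ᶠ n in atTop, PowerSeries.coeff N (FinTranspose.lhs n k) =
      ((FinTranspose.partsPartitions k N).card : ℚ)) ∧
    -- and the right side to the generating function of partitions with no part larger than `k`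
    (∀ N : ℕ, ∀ᶠ n in atTop, PowerSeries.coeff N (FinTranspose.rhs n k) =
      ((FinTranspose.boundedPartitions k N).card : ℚ)) ∧
    -- hence the transpose theorem
    (∀ N : ℕ, (FinTranspose.partsPartitions k N).card =
      (FinTranspose.boundedPartitions k N).card) ∧
    -- and also its form refined by `j = |λ_o| - |λ_e|` and the number of odd parts
    (∀ (N : ℕ) (j : ℤ),
      ((FinTranspose.partsPartitions k N).filter fun l =>
        (FinTranspose.oddIndexSum l : ℤ) - (FinTranspose.evenIndexSum l : ℤ) = j).card =
      ((FinTranspose.boundedPartitions k N).filter fun p =>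
        (FinTranspose.numOddParts p : ℤ) = j).card) := by
  refine ⟨fun n hn => FinTranspose.lhs_eq_rhs hn, fun N => ?_, fun N => ?_,
    FinTranspose.card_partsPartitions k, FinTranspose.card_partsPartitions_alternatingSum k⟩
  · rw [FinTranspose.card_partsPartitions]
    exact FinTranspose.eventually_coeff_lhs k N
  · filter_upwards [FinTranspose.eventually_coeff_lhs k N, eventually_ge_atTop k] with n h hn
    rw [← FinTranspose.lhs_eq_rhs hn, h]
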